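/- Fix $\hbar,\omega,\beta>0$ and put $a=\hbar\omega\beta$. For each $N$ consider $N$ noninteracting bosons in a one-dimensional harmonic trap of frequency $\omega\gamma_N$ with $\gamma_N=\ln N/N$, i.e. with one-particle energies $\varepsilon_j=\hbar\omega\gamma_N(j+\tfrac12)$, $j=0,1,2,\dots$, in the canonical ensemble at inverse temperature $\beta$: an occupation-number configuration $(n_j)_{j\ge 0}$ with $\sum_j n_j=N$ has probability proportional to $e^{-\beta\sum_j\varepsilon_j n_j}$ (these weights have a finite sum for every $N\ge 2$). Let $\langle n_i\rangle_N$ be the mean number of particles in level $i$, and let $a_N=\beta\hbar\omega\gamma_N=a\ln N/N$. For every $a>0$ there is complete generalized Bose-Einstein condensation; for $a>1$ there is no fragmented condensation, but the generalized condensate on the levels $1,2,\dots$ is at its critical point. In detail: (i) For every $a>0$, the number of levels $j<2/a_N$ is $o(N)$, and $$\lim_{N\to\infty}\frac1N\sum_{0\le j<2/a_N}\langle n_j\rangle_N=1 .$$ (ii) If $a<1$, then for every sequence $i=i(N)$ of nonnegative integers with $i=o\left(N^{1-a}/\ln^2 N\right)$, $$\lim_{N\to\infty}N^{-a}\langle n_{i}\rangle_N=1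 .$$ (iii) If $a>1$, then $\lim_{N\to\infty}N^{-1}\langle n_i\rangle_N=0$ for every fixed $i\ge1$, but $\lim_{N\to\infty}N^{-\eta}\langle n_1\rangle_N=\infty$ for every real $\eta<1$; moreover the levels $1,2,\dots$ carry the critical density $1/a$, $$\lim_{N\to\infty}\frac1N\sum_{1\le j<2/a_N}\langle n_j\rangle_N=\frac1a .$$ -/

import Mathlib

open Filter Topology Asymptotics

noncomputable section

namespace BoseGas

/-- The total number of particles of an occupation-number configuration `n`, where `n j` is the
number of bosons in the `j`-th one-particle eigenstate. -/
def totalNumber (n : ℕ →₀ ℕ) : ℕ := n.sum fun _ k => k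

/-- The energy `∑ j, ε j * n j` of a configuration of noninteracting bosons whose one-particle
energies are `ε 0, ε 1, …`. -/
def energy (ε : ℕ → ℝ) (n : ℕ →₀ ℕ) : ℝ := n.sum fun j k => ε j * (k : ℝ)

/-- The occupation-number configurations with `N` particles. They label the orthonormal basis of the
`N`-particle symmetric subspace made of joint eigenvectors of the noninteracting Hamiltonian and
of all occupation-number operators. -/
def Config (N : ℕ) : Type := {n : ℕ →₀ ℕ // totalNumber n = N}

/-- The Boltzmann weight `exp (-β E(n))` of an `N`-particle configuration. -/
def weight (β : ℝ) (ε : ℕ → ℝ) (N : ℕ) (n : Config N) : ℝ := Real.exp (-(β * energy ε n.1))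

/-- The `N`-particle canonical partition function, `Tr exp (-β H)` on the symmetric subspace. -/
def partitionFunction (β : ℝ) (ε : ℕ → ℝ) (N : ℕ) : ℝ := ∑' n : Config N, weight β ε N n

/-- The canonical mean occupation number of level `i`,
`Tr (n_i exp (-β H)) / Tr exp (-β H)` on the `N`-particle symmetric subspace. -/
def meanOccupation (β : ℝ) (ε : ℕ → ℝ) (N i : ℕ) : ℝ :=
  (∑' n : Config N, (n.1 i : ℝ) * weight β ε N n) / partitionFunction β ε N

/-- The scaling `γ_N = ln N / N` of the trap frequency. -/
def trapScale (N : ℕ) : ℝ := Real.log N / N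

/-- The one-particle energies `ħ ω γ_N (j + 1/2)` of the one-dimensional harmonic oscillator with
frequency `ω γ_N`. -/
def trapLevel (hbar omega : ℝ) (N j : ℕ) : ℝ := hbar * (omega * trapScale N) * ((j : ℝ) + 1 / 2)

/-- `⟨n_i⟩` for `N` noninteracting bosons in the scaled harmonic trap at inverse temperature `β`. -/
def trapOccupation (hbar omega beta : ℝ) (N i : ℕ) : ℝ :=
  meanOccupation beta (trapLevel hbar omega N) N i

/-- The number of levels `j` with `j < 2 / a_N`, where `a_N = a ln N / N`
(for a natural number `j`, `j < ⌈x⌉₊` is equivalent to `j < x`). -/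
def levelCutoff (a : ℝ) (N : ℕ) : ℕ := ⌈2 / (a * trapScale N)⌉₊

end BoseGas

end

/-! ### Configurations and the canonical ensemble -/

namespace BoseGas

/-! Equal level spacing makes the canonical ensemble explicitly solvable. Write q for the Boltzmann
factor of one quantum. A configuration either has a particle in level 0, which can be removed, or
arises by raising every particle one level; this gives a first-order recursion for the partition
function, hence one for ⟨n_i⟩. Unrolled (`meanOccupation_eq_sum`), ⟨n_i⟩ is the sum over k < N of
q^{i(k+1)} ∏_{j≤k} (1 - q^{N-j}), and everything is read off from this sum.

In the scaled trap q^{(1-x)N} = N^{-a(1-x)}. If a < 1, the product behaves like (1 - N^{-a})^{k+1},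
so the sum is about N^a, and q^{ik} stays near 1 over the relevant range of k for the low levels. If
a > 1, the product for level 0 drops from 1 to 0 near k = xN with N · N^{-a(1-x)} = 1, that is x = 1
- 1/a, whence ⟨n_0⟩/N → 1 - 1/a. For level 1, terms up to k of order N / ln N are still bounded
below, which gives occupation of at least that order.

The occupations sum to N, and the grand-canonical bound q^i / (1 - q^i) leaves only O(1/a_N) = o(N)
particles above the cutoff. This gives complete generalized condensation; subtracting level 0 leaves
the critical density 1/a. -/

lemma totalNumber_add (m n : ℕ →₀ ℕ) : totalNumber (m + n) = totalNumber m + totalNumber n :=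
  Finsupp.sum_add_index' (fun _ => rfl) (fun _ _ _ => rfl)

lemma totalNumber_single (j k : ℕ) : totalNumber (Finsupp.single j k) = k :=
  Finsupp.sum_single_index rfl

lemma energy_add (ε : ℕ → ℝ) (m n : ℕ →₀ ℕ) : energy ε (m + n) = energy ε m + energy ε n :=
  Finsupp.sum_add_index' (fun _ => by simp) (fun _ _ _ => by push_cast; ring)

lemma energy_single (ε : ℕ → ℝ) (j k : ℕ) : energy ε (Finsupp.single j k) = ε j * k :=
  Finsupp.sum_single_index (by simp)

/-- Adding one particle in level `i`. -/
noncomputable def addParticle (i : ℕ) {N : ℕ} (n : Config N) : Config (N + 1) :=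
  ⟨n.1 + Finsupp.single i 1, by rw [totalNumber_add, totalNumber_single, n.2]⟩

lemma addParticle_injective (i N : ℕ) :
    Function.Injective (addParticle i : Config N → Config (N + 1)) := by
  intro m n h
  exact Subtype.ext (add_right_cancel (congrArg Subtype.val h))

lemma exists_addParticle_eq {N : ℕ} (i : ℕ) (n : Config (N + 1)) (h : n.1 i ≠ 0) :
    ∃ m : Config N, addParticle i m = n := by
  have hle : Finsupp.single i 1 ≤ n.1 := by
    rw [Finsupp.single_le_iff]; exact Nat.one_le_iff_ne_zero.mpr h
  have hadd : (n.1 - Finsupp.single i 1) + Finsupp.single i 1 = n.1 := tsub_add_cancel_of_le hle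
  refine ⟨⟨n.1 - Finsupp.single i 1, ?_⟩, Subtype.ext hadd⟩
  have := congrArg totalNumber hadd
  rw [totalNumber_add, totalNumber_single, n.2] at this
  omega

lemma weight_pos (β : ℝ) (ε : ℕ → ℝ) (N : ℕ) (n : Config N) : 0 < weight β ε N n :=
  Real.exp_pos _

lemma weight_addParticle (β : ℝ) (ε : ℕ → ℝ) (i : ℕ) {N : ℕ} (n : Config N) :
    weight β ε (N + 1) (addParticle i n) = Real.exp (-(β * ε i)) * weight β ε N n := by
  simp only [weight, addParticle, energy_add, energy_single, ← Real.exp_add]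
  congr 1
  push_cast
  ring

lemma totalNumber_eq_zero {n : ℕ →₀ ℕ} (h : totalNumber n = 0) : n = 0 := by
  ext j
  by_contra hj
  exact hj (Finset.sum_eq_zero_iff.mp h j (Finsupp.mem_support_iff.mpr hj))

instance : Unique (Config 0) where
  default := ⟨0, rfl⟩
  uniq n := Subtype.ext (totalNumber_eq_zero n.2)

/-- The canonical ensemble is well defined as soon as the one-particle partition function is
finite. -/
lemma summable_weight {β : ℝ} {ε : ℕ → ℝ} (h : Summable fun j => Real.exp (-(β * ε j))) (N : ℕ) :
    Summable (weight β ε N) := by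
  induction N with
  | zero => exact (hasSum_fintype _).summable
  | succ N ih =>
    have hs := h.mul_of_nonneg ih (fun _ => (Real.exp_pos _).le) (fun n => (weight_pos β ε N n).le)
    have hsurj : Function.Surjective fun p : ℕ × Config N => addParticle p.1 p.2 := by
      intro n
      obtain ⟨i, hi⟩ : ∃ i, n.1 i ≠ 0 := by
        by_contra! hcon
        have h0 : n.1 = 0 := Finsupp.ext hcon
        have := n.2
        rw [h0] at this
        simp [totalNumber] at this
      obtain ⟨m, hm⟩ := exists_addParticle_eq i n hi
      exact ⟨(i, m), hm⟩
    -- A right inverse of the surjection embeds the (N+1)-particle weights, up to equality, as a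
    -- subfamily of the summable products.
    refine (hs.comp_injective (Function.injective_surjInv hsurj)).congr fun n => ?_
    conv_rhs => rw [← Function.surjInv_eq hsurj n]
    exact (weight_addParticle β ε _ _).symm

lemma partitionFunction_pos {β : ℝ} {ε : ℕ → ℝ} {N : ℕ} (h : Summable (weight β ε N)) :
    0 < partitionFunction β ε N :=
  h.tsum_pos (fun n => (weight_pos β ε N n).le)
    ⟨Finsupp.single 0 N, totalNumber_single 0 N⟩ (weight_pos β ε N _)

lemma occupation_le {N : ℕ} (n : Config N) (i : ℕ) : n.1 i ≤ N := by
  by_cases hi : n.1 i = 0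
  · omega
  · conv_rhs => rw [← n.2]
    exact Finset.single_le_sum (f := n.1) (fun _ _ => Nat.zero_le _)
      (Finsupp.mem_support_iff.mpr hi)

lemma summable_occupation_mul_weight {β : ℝ} {ε : ℕ → ℝ} {N : ℕ} (h : Summable (weight β ε N))
    (i : ℕ) : Summable fun n : Config N => (n.1 i : ℝ) * weight β ε N n :=
  Summable.of_nonneg_of_le (fun n => mul_nonneg (Nat.cast_nonneg _) (weight_pos β ε N n).le)
    (fun n => mul_le_mul_of_nonneg_right (Nat.cast_le.mpr (occupation_le n i))
      (weight_pos β ε N n).le) (h.mul_left (N : ℝ))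

/-- Configurations with level `i` empty contribute nothing, so the sum lives on the range of
`addParticle i`, where the occupation is one more than before. -/
lemma tsum_occupation_mul_weight_succ {β : ℝ} {ε : ℕ → ℝ} {N : ℕ} (h : Summable (weight β ε N))
    (i : ℕ) :
    ∑' n : Config (N + 1), (n.1 i : ℝ) * weight β ε (N + 1) n =
      Real.exp (-(β * ε i)) *
        ((∑' n : Config N, (n.1 i : ℝ) * weight β ε N n) + partitionFunction β ε N) := by
  rw [partitionFunction, ← (summable_occupation_mul_weight h i).tsum_add h, ← tsum_mul_left,
    ← (addParticle_injective i N).tsum_eq]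
  · refine tsum_congr fun n => ?_
    rw [weight_addParticle]
    simp only [addParticle, Finsupp.add_apply, Finsupp.single_eq_same]
    push_cast
    ring
  · intro n hn
    refine exists_addParticle_eq i n fun h0 => hn ?_
    simp [h0]

/-- The mean occupation numbers add up to the number of particles. -/
lemma hasSum_meanOccupation {β : ℝ} {ε : ℕ → ℝ} {N : ℕ} (h : Summable (weight β ε N)) :
    HasSum (meanOccupation β ε N) N := by
  have hrow (n : Config N) :
      HasSum (fun j => (n.1 j : ℝ) * weight β ε N n) (N * weight β ε N n) := by
    refine HasSum.mul_right _ ?_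
    have : HasSum (fun j => (n.1 j : ℝ)) (∑ j ∈ n.1.support, (n.1 j : ℝ)) :=
      hasSum_sum_of_ne_finset_zero fun j hj => by simpa using hj
    rwa [← Nat.cast_sum, show ∑ j ∈ n.1.support, n.1 j = N from n.2] at this
  have hprod : Summable fun p : Config N × ℕ => (p.1.1 p.2 : ℝ) * weight β ε N p.1 := by
    refine (summable_prod_of_nonneg fun p =>
      mul_nonneg (Nat.cast_nonneg _) (weight_pos β ε N p.1).le).mpr
      ⟨fun n => (hrow n).summable, ?_⟩
    exact (h.mul_left (N : ℝ)).congr fun n => (hrow n).tsum_eq.symm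
  -- Nonnegativity gave joint summability, so the double sum may be taken by columns (levels)
  -- instead of rows (configurations).
  have hswap := hprod.prod_symm
  have hcol := hswap.hasSum.prod_fiberwise fun j =>
    (summable_occupation_mul_weight h j).hasSum
  have htot : ∑' p : ℕ × Config N, (p.2.1 p.1 : ℝ) * weight β ε N p.2 =
      N * partitionFunction β ε N := by
    rw [partitionFunction, ← tsum_mul_left, ← tsum_congr fun n => (hrow n).tsum_eq,
      ← hprod.tsum_prod' fun n => (hrow n).summable]
    exact (Equiv.prodComm ℕ (Config N)).tsum_eq
      (fun p : Config N × ℕ => (p.1.1 p.2 : ℝ) * weight β ε N p.1)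
  have hdiv := hcol.div_const (partitionFunction β ε N)
  simp only [Prod.fst_swap, Prod.snd_swap] at hdiv
  rw [htot, mul_div_cancel_right₀ _ (partitionFunction_pos h).ne'] at hdiv
  exact hdiv

/-! ### Recursions and closed form for equally spaced levels -/

/-- Raising every particle by one level. -/
noncomputable def raise {N : ℕ} (n : Config N) : Config N :=
  ⟨n.1.mapDomain Nat.succ, by
    conv_rhs => rw [← n.2]
    exact Finsupp.sum_mapDomain_index (fun _ => rfl) (fun _ _ _ => rfl)⟩

lemma raise_injective (N : ℕ) : Function.Injective (raise : Config N → Config N) := by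
  intro m n h
  exact Subtype.ext (Finsupp.mapDomain_injective Nat.succ_injective (congrArg Subtype.val h))

lemma raise_apply_zero {N : ℕ} (n : Config N) : (raise n).1 0 = 0 :=
  Finsupp.mapDomain_of_notMem_range _ _ (by simp)

lemma exists_raise_eq {N : ℕ} (n : Config N) (h : n.1 0 = 0) : ∃ m : Config N, raise m = n := by
  have hmap : (n.1.comapDomain Nat.succ Nat.succ_injective.injOn).mapDomain Nat.succ = n.1 := by
    refine Finsupp.mapDomain_comapDomain _ Nat.succ_injective _ fun j hj => ?_
    rcases j with _ | j
    · exact absurd h (Finsupp.mem_support_iff.mp hj)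
    · exact ⟨j, rfl⟩
  refine ⟨⟨n.1.comapDomain Nat.succ Nat.succ_injective.injOn, ?_⟩, Subtype.ext hmap⟩
  conv_rhs => rw [← n.2, ← hmap]
  exact (Finsupp.sum_mapDomain_index (h := fun _ k => k) (fun _ => rfl) (fun _ _ _ => rfl)).symm

lemma weight_raise {β t : ℝ} {ε : ℕ → ℝ} (hε : ∀ j, β * ε j = t * (j + 1 / 2)) {N : ℕ}
    (n : Config N) : weight β ε N (raise n) = Real.exp (-t) ^ N * weight β ε N n := by
  have hE : β * energy ε (raise n).1 = β * energy ε n.1 + t * N := by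
    have h1 : energy ε (raise n).1 = n.1.sum fun j k => ε (j + 1) * (k : ℝ) :=
      Finsupp.sum_mapDomain_index (fun _ => by simp) (fun _ _ _ => by push_cast; ring)
    have h2 : (N : ℝ) = n.1.sum fun _ k => (k : ℝ) := by
      conv_lhs => rw [← n.2]
      simp [totalNumber, Finsupp.sum]
    rw [h1, h2, energy, Finsupp.sum, Finsupp.sum, Finsupp.sum, Finset.mul_sum, Finset.mul_sum,
      Finset.mul_sum, ← Finset.sum_add_distrib]
    refine Finset.sum_congr rfl fun j _ => ?_
    rw [← mul_assoc, ← mul_assoc, hε, hε]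
    push_cast
    ring
  rw [weight, weight, hE, ← Real.exp_nat_mul, ← Real.exp_add]
  congr 1
  ring

lemma summable_exp_neg_harmonic {β t : ℝ} {ε : ℕ → ℝ} (ht : 0 < t)
    (hε : ∀ j, β * ε j = t * (j + 1 / 2)) : Summable fun j => Real.exp (-(β * ε j)) := by
  have : Summable fun j : ℕ => Real.exp (-(t / 2)) * Real.exp (-t) ^ j :=
    (summable_geometric_of_lt_one (Real.exp_pos _).le (by simpa using ht)).mul_left _
  refine this.congr fun j => ?_
  rw [hε, ← Real.exp_nat_mul, ← Real.exp_add]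
  congr 1
  ring

/-- Split the configurations according to whether level `0` is occupied. -/
lemma partitionFunction_succ {β t : ℝ} {ε : ℕ → ℝ} (ht : 0 < t)
    (hε : ∀ j, β * ε j = t * (j + 1 / 2)) (N : ℕ) :
    partitionFunction β ε (N + 1) * (1 - Real.exp (-t) ^ (N + 1)) =
      Real.exp (-(β * ε 0)) * partitionFunction β ε N := by
  have hs := summable_weight (summable_exp_neg_harmonic ht hε)
  have hbij : Function.Bijective
      (Sum.elim (addParticle 0) raise : Config N ⊕ Config (N + 1) → Config (N + 1)) := by
    constructor
    · refine (addParticle_injective 0 N).sumElim (raise_injective (N + 1)) fun m n hmn => ?_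
      have := congrArg (fun c : Config (N + 1) => c.1 0) hmn
      simp only [raise_apply_zero] at this
      simp [addParticle] at this
    · intro n
      by_cases h0 : n.1 0 = 0
      · obtain ⟨m, hm⟩ := exists_raise_eq n h0
        exact ⟨Sum.inr m, hm⟩
      · obtain ⟨m, hm⟩ := exists_addParticle_eq 0 n h0
        exact ⟨Sum.inl m, hm⟩
  have h1 : HasSum (fun n : Config N => weight β ε (N + 1) (addParticle 0 n))
      (Real.exp (-(β * ε 0)) * partitionFunction β ε N) := by
    simp only [weight_addParticle]
    exact (hs N).hasSum.mul_left _
  -- The raised configurations reproduce the (N+1)-particle partition function itself, so the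
  -- identity can be solved for it.
  have h2 : HasSum (fun n : Config (N + 1) => weight β ε (N + 1) (raise n))
      (Real.exp (-t) ^ (N + 1) * partitionFunction β ε (N + 1)) := by
    simp only [weight_raise hε]
    exact (hs (N + 1)).hasSum.mul_left _
  have h3 : HasSum (weight β ε (N + 1) ∘ Equiv.ofBijective _ hbij)
      (Real.exp (-(β * ε 0)) * partitionFunction β ε N +
        Real.exp (-t) ^ (N + 1) * partitionFunction β ε (N + 1)) := HasSum.sum h1 h2
  have h4 : partitionFunction β ε (N + 1) = _ := ((Equiv.hasSum_iff _).mp h3).tsum_eq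
  linear_combination h4

lemma meanOccupation_zero (β : ℝ) (ε : ℕ → ℝ) (i : ℕ) : meanOccupation β ε 0 i = 0 := by
  have (n : Config 0) : n.1 i = 0 := Nat.le_zero.mp (occupation_le n i)
  simp [meanOccupation, this]

lemma meanOccupation_succ {β t : ℝ} {ε : ℕ → ℝ} (ht : 0 < t)
    (hε : ∀ j, β * ε j = t * (j + 1 / 2)) (N i : ℕ) :
    meanOccupation β ε (N + 1) i =
      Real.exp (-t) ^ i * (1 - Real.exp (-t) ^ (N + 1)) * (meanOccupation β ε N i + 1) := by
  have hs := summable_weight (summable_exp_neg_harmonic ht hε)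
  have hZ := (partitionFunction_pos (hs N)).ne'
  have hZ' := (partitionFunction_pos (hs (N + 1))).ne'
  have hrec := partitionFunction_succ ht hε N
  have hexp : Real.exp (-(β * ε i)) = Real.exp (-t) ^ i * Real.exp (-(β * ε 0)) := by
    rw [hε, hε, ← Real.exp_nat_mul, ← Real.exp_add]
    congr 1
    push_cast
    ring
  rw [meanOccupation, tsum_occupation_mul_weight_succ (hs N), hexp, meanOccupation,
    div_add_one hZ, div_eq_iff hZ', mul_div_assoc', div_mul_eq_mul_div, eq_div_iff hZ]
  linear_combination (-(Real.exp (-t) ^ i) *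
    ((∑' n : Config N, (n.1 i : ℝ) * weight β ε N n) + partitionFunction β ε N)) * hrec

/-- The canonical mean occupation numbers of the harmonic oscillator in closed form. The `k`-th
term is the probability that at least `k + 1` particles are in level `i`. -/
lemma meanOccupation_eq_sum {β t : ℝ} {ε : ℕ → ℝ} (ht : 0 < t)
    (hε : ∀ j, β * ε j = t * (j + 1 / 2)) (N i : ℕ) :
    meanOccupation β ε N i = ∑ k ∈ Finset.range N,
      (Real.exp (-t) ^ i) ^ (k + 1) * ∏ j ∈ Finset.range (k + 1), (1 - Real.exp (-t) ^ (N - j)) := by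
  induction N with
  | zero => simp [meanOccupation_zero]
  | succ N ih =>
    rw [meanOccupation_succ ht hε, ih, Finset.sum_range_succ', mul_add, Finset.mul_sum]
    congr 1
    · refine Finset.sum_congr rfl fun k _ => ?_
      rw [Finset.prod_range_succ' _ (k + 1)]
      simp only [Nat.add_sub_add_right, Nat.sub_zero]
      ring
    · simp

/-- The closed form of the canonical mean occupation of level `i` of the harmonic oscillator with
`N` bosons, as a function of the Boltzmann factor `q` of one energy quantum. -/
noncomputable def oscillatorOccupation (q : ℝ) (N i : ℕ) : ℝ :=
  ∑ k ∈ Finset.range N, (q ^ i) ^ (k + 1) * ∏ j ∈ Finset.range (k + 1), (1 - q ^ (N - j))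

/-! ### Bounds on the closed form at fixed q -/

section Bounds

variable {q : ℝ} (hq0 : 0 < q) (hq1 : q < 1)

include hq0 hq1

lemma prod_one_sub_pow_nonneg (N k : ℕ) : 0 ≤ ∏ j ∈ Finset.range k, (1 - q ^ (N - j)) :=
  Finset.prod_nonneg fun _ _ => sub_nonneg.mpr (pow_le_one₀ hq0.le hq1.le)

lemma prod_one_sub_pow_le_one (N k : ℕ) : ∏ j ∈ Finset.range k, (1 - q ^ (N - j)) ≤ 1 :=
  Finset.prod_le_one (fun _ _ => sub_nonneg.mpr (pow_le_one₀ hq0.le hq1.le))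
    fun _ _ => sub_le_self _ (by positivity)

/-- The factors decrease in j: drop the first `l` and replace each remaining one by the factor at j
= `l`. -/
lemma prod_one_sub_pow_le {k l : ℕ} (hlk : l ≤ k) (N : ℕ) :
    ∏ j ∈ Finset.range k, (1 - q ^ (N - j)) ≤ (1 - q ^ (N - l)) ^ (k - l) := by
  rw [← Finset.prod_range_mul_prod_Ico _ hlk]
  calc _ ≤ 1 * ∏ j ∈ Finset.Ico l k, (1 - q ^ (N - j)) := by
        refine mul_le_mul_of_nonneg_right (prod_one_sub_pow_le_one hq0 hq1 N l) ?_
        exact Finset.prod_nonneg fun _ _ => sub_nonneg.mpr (pow_le_one₀ hq0.le hq1.le)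
    _ ≤ ∏ j ∈ Finset.Ico l k, (1 - q ^ (N - l)) := by
        rw [one_mul]
        refine Finset.prod_le_prod (fun _ _ => sub_nonneg.mpr (pow_le_one₀ hq0.le hq1.le))
          fun j hj => sub_le_sub_left (pow_le_pow_of_le_one hq0.le hq1.le ?_) _
        have := (Finset.mem_Ico.mp hj).1
        omega
    _ = _ := by simp

lemma le_prod_one_sub_pow {k K : ℕ} (hk : k ≤ K) (N : ℕ) :
    (1 - q ^ (N - K)) ^ k ≤ ∏ j ∈ Finset.range k, (1 - q ^ (N - j)) := by
  calc (1 - q ^ (N - K)) ^ k = ∏ j ∈ Finset.range k, (1 - q ^ (N - K)) := by simp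
    _ ≤ _ := Finset.prod_le_prod (fun _ _ => sub_nonneg.mpr (pow_le_one₀ hq0.le hq1.le))
          fun j hj => sub_le_sub_left (pow_le_pow_of_le_one hq0.le hq1.le (by
            have := Finset.mem_range.mp hj
            omega)) _

/-- The grand-canonical bound at the lowest admissible chemical potential. -/
lemma oscillatorOccupation_le_div (N : ℕ) {i : ℕ} (hi : i ≠ 0) :
    oscillatorOccupation q N i ≤ q ^ i / (1 - q ^ i) := by
  have hqi : q ^ i < 1 := pow_lt_one₀ hq0.le hq1 hi
  rw [le_div_iff₀ (sub_pos.mpr hqi)]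
  calc oscillatorOccupation q N i * (1 - q ^ i)
      ≤ (∑ k ∈ Finset.range N, (q ^ i) ^ (k + 1)) * (1 - q ^ i) := by
        refine mul_le_mul_of_nonneg_right (Finset.sum_le_sum fun k _ => ?_)
          (sub_pos.mpr hqi).le
        exact mul_le_of_le_one_right (by positivity) (prod_one_sub_pow_le_one hq0 hq1 _ _)
    _ = q ^ i * (1 - (q ^ i) ^ N) := by
        simp only [pow_succ]
        rw [← Finset.sum_mul, mul_right_comm, geom_sum_mul_neg]
        ring
    _ ≤ q ^ i := mul_le_of_le_one_right (by positivity) (sub_le_self _ (by positivity))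

/-- Comparison with the geometric series of ratio 1 - q^N, whose sum is q^{-N}. -/
lemma pow_mul_oscillatorOccupation_le_one (N i : ℕ) :
    q ^ N * oscillatorOccupation q N i ≤ 1 := by
  have hr : 0 ≤ 1 - q ^ N := sub_nonneg.mpr (pow_le_one₀ hq0.le hq1.le)
  calc q ^ N * oscillatorOccupation q N i
      ≤ q ^ N * ∑ k ∈ Finset.range N, (1 - q ^ N) ^ k := by
        refine mul_le_mul_of_nonneg_left (Finset.sum_le_sum fun k _ => ?_) (by positivity)
        have h1 := prod_one_sub_pow_le hq0 hq1 (Nat.zero_le (k + 1)) N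
        have h2 : (q ^ i) ^ (k + 1) ≤ 1 :=
          pow_le_one₀ (by positivity) (pow_le_one₀ hq0.le hq1.le)
        calc _ ≤ 1 * (1 - q ^ N) ^ (k + 1) :=
              mul_le_mul h2 h1 (prod_one_sub_pow_nonneg hq0 hq1 _ _) zero_le_one
          _ ≤ _ := by
              rw [one_mul, pow_succ]
              exact mul_le_of_le_one_right (by positivity) (sub_le_self _ (by positivity))
    _ = 1 - (1 - q ^ N) ^ N := by
        have := geom_sum_mul_neg (1 - q ^ N) N
        rw [← this]
        ring
    _ ≤ 1 := sub_le_self _ (by positivity)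

/-- Source of both lower bounds: keep `K` terms and use the smallest admissible factors. -/
lemma sum_le_oscillatorOccupation {N K : ℕ} (hK : K ≤ N) (i : ℕ) :
    (q ^ i) ^ K * ∑ k ∈ Finset.range K, (1 - q ^ (N - K)) ^ (k + 1) ≤
      oscillatorOccupation q N i := by
  rw [Finset.mul_sum]
  calc _ ≤ ∑ k ∈ Finset.range K,
        (q ^ i) ^ (k + 1) * ∏ j ∈ Finset.range (k + 1), (1 - q ^ (N - j)) := by
        refine Finset.sum_le_sum fun k hk => ?_
        have hk' : k + 1 ≤ K := Finset.mem_range.mp hk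
        refine mul_le_mul ?_ (le_prod_one_sub_pow hq0 hq1 hk' N) ?_ (by positivity)
        · exact pow_le_pow_of_le_one (by positivity) (pow_le_one₀ hq0.le hq1.le) hk'
        · exact pow_nonneg (sub_nonneg.mpr (pow_le_one₀ hq0.le hq1.le)) _
    _ ≤ _ := by
        refine Finset.sum_le_sum_of_subset_of_nonneg (Finset.range_subset_range.mpr hK)
          fun k _ _ => mul_nonneg (by positivity) (prod_one_sub_pow_nonneg hq0 hq1 _ _)

/-- Bernoulli's inequality; effective when K q^{N-K} is small, as for a > 1. -/
lemma mul_le_oscillatorOccupation {N K : ℕ} (hK : K ≤ N) (i : ℕ) :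
    (q ^ i) ^ K * (K * (1 - K * q ^ (N - K))) ≤ oscillatorOccupation q N i := by
  refine le_trans (mul_le_mul_of_nonneg_left ?_ (by positivity))
    (sum_le_oscillatorOccupation hq0 hq1 hK i)
  have hp : q ^ (N - K) ≤ 1 := pow_le_one₀ hq0.le hq1.le
  calc (K : ℝ) * (1 - K * q ^ (N - K))
      = ∑ k ∈ Finset.range K, (1 - K * q ^ (N - K)) := by
        rw [Finset.sum_const, Finset.card_range, nsmul_eq_mul]
    _ ≤ _ := by
        refine Finset.sum_le_sum fun k hk => ?_
        have hk' : k + 1 ≤ K := Finset.mem_range.mp hk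
        calc 1 - K * q ^ (N - K) ≤ (1 - q ^ (N - K)) ^ K := by
              have := one_add_mul_le_pow (a := -q ^ (N - K)) (by linarith) K
              rw [← sub_eq_add_neg] at this
              linarith
          _ ≤ _ := pow_le_pow_of_le_one (by linarith) (sub_le_self _ (by positivity)) hk'

/-- Sums the geometric series exactly, for the regime a < 1 where `K` must exceed q^{-N}. -/
lemma pow_mul_le_pow_mul_oscillatorOccupation {N K : ℕ} (hK : K ≤ N) (i : ℕ) :
    q ^ K * ((q ^ i) ^ K * ((1 - q ^ (N - K)) - (1 - q ^ (N - K)) ^ (K + 1))) ≤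
      q ^ N * oscillatorOccupation q N i := by
  have h := mul_le_mul_of_nonneg_left (sum_le_oscillatorOccupation hq0 hq1 hK i)
    (by positivity : 0 ≤ q ^ N)
  refine le_trans (le_of_eq ?_) h
  have hqN : q ^ N = q ^ K * q ^ (N - K) := by rw [← pow_add, Nat.add_sub_cancel' hK]
  have hg : (1 - q ^ (N - K)) - (1 - q ^ (N - K)) ^ (K + 1) =
      q ^ (N - K) * ∑ k ∈ Finset.range K, (1 - q ^ (N - K)) ^ (k + 1) := by
    have := geom_sum_mul_neg (1 - q ^ (N - K)) K
    simp only [pow_succ _ (_ : ℕ)]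
    rw [← Finset.sum_mul]
    linear_combination (-(1 - q ^ (N - K))) * this
  rw [hg, hqN]
  ring

/-- The first `K` terms are at most 1; each later one has at least `K - L` factors beyond index `L`,
each at most exp(-q^{N-L}). -/
lemma oscillatorOccupation_zero_le {N K L : ℕ} (hLK : L ≤ K) :
    oscillatorOccupation q N 0 ≤ K + N * Real.exp (-((K - L : ℝ) * q ^ (N - L))) := by
  have hterm (k : ℕ) : (q ^ 0) ^ (k + 1) * ∏ j ∈ Finset.range (k + 1), (1 - q ^ (N - j)) ≤
      (if k < K then 1 else 0) + Real.exp (-((K - L : ℝ) * q ^ (N - L))) := by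
    rw [pow_zero, one_pow, one_mul]
    split_ifs with hk
    · have := prod_one_sub_pow_le_one hq0 hq1 N (k + 1)
      have := Real.exp_pos (-((K - L : ℝ) * q ^ (N - L)))
      linarith
    · rw [zero_add]
      have hr : 0 ≤ 1 - q ^ (N - L) := sub_nonneg.mpr (pow_le_one₀ hq0.le hq1.le)
      calc _ ≤ (1 - q ^ (N - L)) ^ (k + 1 - L) := prod_one_sub_pow_le hq0 hq1 (by omega) N
        _ ≤ (1 - q ^ (N - L)) ^ (K - L) :=
            pow_le_pow_of_le_one hr (sub_le_self _ (by positivity)) (by omega)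
        _ ≤ Real.exp (-q ^ (N - L)) ^ (K - L) :=
            pow_le_pow_left₀ hr (Real.one_sub_le_exp_neg _) _
        _ = _ := by
            rw [← Real.exp_nat_mul, Nat.cast_sub hLK]
            congr 1
            ring
  refine (Finset.sum_le_sum fun k _ => hterm k).trans ?_
  rw [Finset.sum_add_distrib, Finset.sum_const, Finset.card_range, nsmul_eq_mul]
  refine add_le_add_left ?_ _
  rw [← Finset.sum_filter, Finset.sum_const, nsmul_eq_mul, mul_one]
  have : (Finset.range N).filter (· < K) ⊆ Finset.range K := fun k hk => by
    simp at hk ⊢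
    exact hk.2
  exact_mod_cast (Finset.card_le_card this).trans_eq (Finset.card_range K)

end Bounds

/-! ### The scaled trap and the sum rule -/

section Scaling

lemma trapScale_pos {N : ℕ} (hN : 2 ≤ N) : 0 < trapScale N :=
  div_pos (Real.log_pos (by exact_mod_cast hN)) (by positivity)

/-- The Boltzmann factor of one energy quantum of the scaled trap. -/
noncomputable def trapFactor (a : ℝ) (N : ℕ) : ℝ := Real.exp (-(a * trapScale N))

lemma trapFactor_pos (a : ℝ) (N : ℕ) : 0 < trapFactor a N := Real.exp_pos _

lemma trapFactor_lt_one {a : ℝ} (ha : 0 < a) {N : ℕ} (hN : 2 ≤ N) : trapFactor a N < 1 :=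
  Real.exp_lt_one_iff.mpr (neg_lt_zero.mpr (mul_pos ha (trapScale_pos hN)))

lemma trapFactor_pow (a : ℝ) (N k : ℕ) :
    trapFactor a N ^ k = Real.exp (-(a * trapScale N * k)) := by
  rw [trapFactor, ← Real.exp_nat_mul]
  congr 1
  ring

lemma exp_neg_mul_trapScale (a x : ℝ) {N : ℕ} (hN : 2 ≤ N) :
    Real.exp (-(a * trapScale N * (x * N))) = (N : ℝ) ^ (-(a * x)) := by
  have : (0 : ℝ) < N := by positivity
  rw [Real.rpow_def_of_pos this, trapScale]
  congr 1
  field_simp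

lemma trapFactor_pow_self (a : ℝ) {N : ℕ} (hN : 2 ≤ N) :
    trapFactor a N ^ N = (N : ℝ) ^ (-a) := by
  rw [trapFactor_pow, ← one_mul (N : ℝ), ← mul_assoc, mul_assoc _ 1, exp_neg_mul_trapScale a 1 hN,
    mul_one, one_mul]

lemma trapLevel_eq {hbar omega beta a : ℝ} (ha : a = hbar * omega * beta) (N j : ℕ) :
    beta * trapLevel hbar omega N j = a * trapScale N * (j + 1 / 2) := by
  rw [trapLevel, ha]
  ring

lemma trapOccupation_eq {hbar omega beta a : ℝ} (ha : a = hbar * omega * beta) (ha0 : 0 < a)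
    {N : ℕ} (hN : 2 ≤ N) (i : ℕ) :
    trapOccupation hbar omega beta N i = oscillatorOccupation (trapFactor a N) N i :=
  meanOccupation_eq_sum (mul_pos ha0 (trapScale_pos hN)) (trapLevel_eq ha N) N i

lemma hasSum_oscillatorOccupation {t : ℝ} (ht : 0 < t) (N : ℕ) :
    HasSum (oscillatorOccupation (Real.exp (-t)) N) N := by
  have hε (j : ℕ) : (1 : ℝ) * (t * ((j : ℝ) + 1 / 2)) = t * (j + 1 / 2) := one_mul _
  exact (hasSum_meanOccupation (summable_weight (summable_exp_neg_harmonic ht hε) N)).congr_fun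
    fun i => (meanOccupation_eq_sum ht hε N i).symm

end Scaling

lemma sum_range_oscillatorOccupation_le {t : ℝ} (ht : 0 < t) (N L : ℕ) :
    ∑ j ∈ Finset.range L, oscillatorOccupation (Real.exp (-t)) N j ≤ N := by
  refine sum_le_hasSum _ (fun j _ => ?_) (hasSum_oscillatorOccupation ht N)
  exact Finset.sum_nonneg fun k _ => mul_nonneg (by positivity)
    (prod_one_sub_pow_nonneg (Real.exp_pos _) (by simpa using ht) _ _)

lemma exp_neg_pow_le_half {t : ℝ} {L : ℕ} (hL : 2 ≤ t * L) : Real.exp (-t) ^ L ≤ 1 / 2 := by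
  rw [← Real.exp_nat_mul, mul_neg, Real.exp_neg, one_div]
  refine inv_anti₀ two_pos ?_
  have := Real.add_one_le_exp ((L : ℝ) * t)
  linarith

/-- The levels above `2 / t` hold `O(1 / t)` particles. -/
lemma sub_le_sum_range_oscillatorOccupation {t : ℝ} (ht : 0 < t) (N : ℕ) {L : ℕ}
    (hL : 2 ≤ t * L) :
    N - (1 + 1 / t) ≤ ∑ j ∈ Finset.range L, oscillatorOccupation (Real.exp (-t)) N j := by
  set q := Real.exp (-t) with hq
  have hq0 : 0 < q := Real.exp_pos _
  have hq1 : q < 1 := by simpa [hq] using ht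
  have hqL : q ^ L ≤ 1 / 2 := exp_neg_pow_le_half hL
  have hL0 : L ≠ 0 := by
    rintro rfl
    norm_num at hL
  have hsum := (hasSum_nat_add_iff' L).mpr (hasSum_oscillatorOccupation ht N)
  have hgeo := hasSum_geometric_of_lt_one hq0.le hq1
  have htail : N - ∑ j ∈ Finset.range L, oscillatorOccupation q N j ≤ (1 - q)⁻¹ := by
    refine hasSum_le (fun j => ?_) hsum hgeo
    refine (oscillatorOccupation_le_div hq0 hq1 N (by omega)).trans ?_
    have hle : q ^ (j + L) ≤ q ^ L := pow_le_pow_of_le_one hq0.le hq1.le (by omega)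
    -- The denominator is at least 1/2 ≥ q^L, so the tail is dominated by the plain geometric series
    -- in q.
    rw [div_le_iff₀ (by linarith), pow_add]
    refine mul_le_mul_of_nonneg_left ?_ (by positivity)
    rw [← pow_add]
    linarith
  have hinv : (1 - q)⁻¹ ≤ 1 + 1 / t := by
    have h1 : (1 + t) * q ≤ 1 := by
      have := mul_le_mul_of_nonneg_right (Real.add_one_le_exp t) hq0.le
      rwa [hq, ← Real.exp_add, add_neg_cancel, Real.exp_zero, add_comm] at this
    rw [show 1 + 1 / t = (t / (1 + t))⁻¹ by field_simp; ring]
    refine inv_anti₀ (by positivity) ?_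
    rw [div_le_iff₀ (by positivity)]
    linarith
  linarith

/-! ### Limits as N → ∞ -/

lemma tendsto_log_natCast_atTop : Tendsto (fun N : ℕ => Real.log N) atTop atTop :=
  Real.tendsto_log_atTop.comp tendsto_natCast_atTop_atTop

lemma tendsto_log_rpow_mul_rpow_neg (r : ℝ) {s : ℝ} (hs : 0 < s) :
    Tendsto (fun N : ℕ => Real.log N ^ r * (N : ℝ) ^ (-s)) atTop (𝓝 0) := by
  have := (isLittleO_log_rpow_rpow_atTop r hs).tendsto_div_nhds_zero.comp
    tendsto_natCast_atTop_atTop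
  refine this.congr fun N => ?_
  simp only [Function.comp_apply]
  rw [Real.rpow_neg (Nat.cast_nonneg N), div_eq_mul_inv]

lemma tendsto_natCast_rpow_neg {s : ℝ} (hs : 0 < s) :
    Tendsto (fun N : ℕ => (N : ℝ) ^ (-s)) atTop (𝓝 0) :=
  (tendsto_rpow_neg_atTop hs).comp tendsto_natCast_atTop_atTop

variable {a : ℝ}

lemma tendsto_one_div_mul_trapScale_div (ha : 0 < a) :
    Tendsto (fun N : ℕ => 1 / (a * trapScale N) / N) atTop (𝓝 0) := by
  refine (tendsto_log_natCast_atTop.const_mul_atTop ha).inv_tendsto_atTop.congr' ?_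
  filter_upwards [eventually_ge_atTop 2] with N hN
  have h : (N : ℝ) ≠ 0 := by positivity
  rw [Pi.inv_apply, trapScale, div_div, mul_assoc, div_mul_cancel₀ _ h, one_div]

lemma isLittleO_levelCutoff (ha : 0 < a) :
    (fun N : ℕ => (levelCutoff a N : ℝ)) =o[atTop] (fun N : ℕ => (N : ℝ)) := by
  have hne : ∀ᶠ N : ℕ in atTop, (N : ℝ) = 0 → (levelCutoff a N : ℝ) = 0 := by
    filter_upwards [eventually_ge_atTop 1] with N hN h0
    exact absurd h0 (by positivity)
  rw [isLittleO_iff_tendsto' hne]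
  have hlim : Tendsto (fun N : ℕ => 2 * (1 / (a * trapScale N) / N) + 1 / (N : ℝ)) atTop (𝓝 0) := by
    simpa using ((tendsto_one_div_mul_trapScale_div ha).const_mul 2).add
      tendsto_one_div_atTop_nhds_zero_nat
  refine squeeze_zero' (Eventually.of_forall fun N => by positivity) ?_ hlim
  filter_upwards [eventually_ge_atTop 2] with N hN
  have ht : 0 < a * trapScale N := mul_pos ha (trapScale_pos hN)
  have h := (Nat.ceil_lt_add_one (div_pos two_pos ht).le).le
  calc (levelCutoff a N : ℝ) / N ≤ (2 / (a * trapScale N) + 1) / N :=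
        div_le_div_of_nonneg_right h (Nat.cast_nonneg N)
    _ = _ := by ring

lemma tendsto_sum_range_levelCutoff (ha : 0 < a) :
    Tendsto (fun N : ℕ => (1 / (N : ℝ)) *
      ∑ j ∈ Finset.range (levelCutoff a N), oscillatorOccupation (trapFactor a N) N j)
      atTop (𝓝 1) := by
  have hlim : Tendsto (fun N : ℕ => 1 - (1 / (N : ℝ) + 1 / (a * trapScale N) / N))
      atTop (𝓝 1) := by
    simpa using (tendsto_one_div_atTop_nhds_zero_nat.add
      (tendsto_one_div_mul_trapScale_div ha)).const_sub (1 : ℝ)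
  refine tendsto_of_tendsto_of_tendsto_of_le_of_le' hlim tendsto_const_nhds ?_ ?_
  · filter_upwards [eventually_ge_atTop 2] with N hN
    have ht : 0 < a * trapScale N := mul_pos ha (trapScale_pos hN)
    have hN0 : (0 : ℝ) < N := by positivity
    have hL : 2 ≤ a * trapScale N * levelCutoff a N := by
      have := Nat.le_ceil (2 / (a * trapScale N))
      rwa [div_le_iff₀ ht, mul_comm] at this
    have h := sub_le_sum_range_oscillatorOccupation ht N hL
    rw [one_div_mul_eq_div, le_div_iff₀ hN0]
    refine le_trans (le_of_eq ?_) h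
    field_simp
  · filter_upwards [eventually_ge_atTop 2] with N hN
    have hN0 : (0 : ℝ) < N := by positivity
    rw [one_div_mul_eq_div, div_le_one hN0]
    exact sum_range_oscillatorOccupation_le (mul_pos ha (trapScale_pos hN)) N _

/-- The grand-canonical bound is at most 1/a_N, which is o(N). -/
lemma tendsto_oscillatorOccupation_div (ha : 0 < a) {i : ℕ} (hi : 1 ≤ i) :
    Tendsto (fun N : ℕ => (1 / (N : ℝ)) * oscillatorOccupation (trapFactor a N) N i)
      atTop (𝓝 0) := by
  refine squeeze_zero' (g := fun N : ℕ => 1 / (a * trapScale N) / N) ?_ ?_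
    (tendsto_one_div_mul_trapScale_div ha)
  · filter_upwards [eventually_ge_atTop 2] with N hN
    refine mul_nonneg (by positivity) (Finset.sum_nonneg fun k _ => mul_nonneg ?_ ?_)
    · have := trapFactor_pos a N
      positivity
    · exact prod_one_sub_pow_nonneg (trapFactor_pos a N) (trapFactor_lt_one ha hN) _ _
  · filter_upwards [eventually_ge_atTop 2] with N hN
    have ht : 0 < a * trapScale N := mul_pos ha (trapScale_pos hN)
    have hq0 := trapFactor_pos a N
    have hq1 := trapFactor_lt_one ha hN
    rw [one_div_mul_eq_div]
    refine div_le_div_of_nonneg_right ?_ (Nat.cast_nonneg N)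
    refine (oscillatorOccupation_le_div hq0 hq1 N (by omega)).trans ?_
    have hqi : trapFactor a N ^ i < 1 := pow_lt_one₀ hq0.le hq1 (by omega)
    rw [div_le_div_iff₀ (by linarith) ht, one_mul]
    have hle : trapFactor a N ^ i ≤ trapFactor a N := pow_le_of_le_one hq0.le hq1.le (by omega)
    have hexp : trapFactor a N * (1 + a * trapScale N) ≤ 1 := by
      have := mul_le_mul_of_nonneg_left (Real.add_one_le_exp (a * trapScale N)) hq0.le
      rwa [trapFactor, ← Real.exp_add, neg_add_cancel, Real.exp_zero, add_comm] at this
    have := mul_le_mul_of_nonneg_right hle (by linarith : 0 ≤ 1 + a * trapScale N)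
    linarith

/-- The occupation of the ground level in the condensed phase. -/
lemma tendsto_oscillatorOccupation_zero_div (ha : 1 < a) :
    Tendsto (fun N : ℕ => (1 / (N : ℝ)) * oscillatorOccupation (trapFactor a N) N 0)
      atTop (𝓝 (1 - 1 / a)) := by
  have ha0 : 0 < a := one_pos.trans ha
  have hinv : 1 / a < 1 := (div_lt_one ha0).mpr ha
  refine tendsto_order.mpr ⟨fun b hb => ?_, fun b hb => ?_⟩
  -- Below x = 1 - 1/a one has a(1 - x) > 1, so K = ⌊xN⌋ makes K q^{N-K} vanish in the Bernoulli
  -- bound.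
  · obtain ⟨x, hx1, hx2⟩ := exists_between (max_lt hb (sub_pos.mpr hinv))
    have hx0 : 0 < x := (le_max_right _ _).trans_lt hx1
    have hax : 0 < a * (1 - x) - 1 := by
      have := mul_lt_mul_of_pos_left hx2 ha0
      rw [mul_sub, mul_one_div_cancel ha0.ne'] at this
      linarith
    have hlim : Tendsto (fun N : ℕ => (⌊x * N⌋₊ : ℝ) / N * (1 - (N : ℝ) ^ (-(a * (1 - x) - 1))))
        atTop (𝓝 x) := by
      have h1 := (tendsto_nat_floor_mul_div_atTop hx0.le).comp
        (tendsto_natCast_atTop_atTop (R := ℝ))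
      simpa using h1.mul ((tendsto_natCast_rpow_neg hax).const_sub 1)
    filter_upwards [hlim.eventually_const_lt ((le_max_left _ _).trans_lt hx1),
      eventually_ge_atTop 2] with N hbN hN
    refine hbN.trans_le ?_
    have hN0 : (0 : ℝ) < N := by positivity
    have hfl : (⌊x * N⌋₊ : ℝ) ≤ x * N := Nat.floor_le (by positivity)
    have hxN : x * N ≤ N := mul_le_of_le_one_left hN0.le (by linarith [one_div_pos.mpr ha0])
    have hK : ⌊x * N⌋₊ ≤ N := by exact_mod_cast hfl.trans hxN
    have h := mul_le_oscillatorOccupation (trapFactor_pos a N) (trapFactor_lt_one ha0 hN) hK 0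
    rw [pow_zero, one_pow, one_mul] at h
    rw [one_div_mul_eq_div, div_mul_eq_mul_div]
    refine div_le_div_of_nonneg_right (le_trans ?_ h) hN0.le
    refine mul_le_mul_of_nonneg_left (sub_le_sub_left ?_ _) (Nat.cast_nonneg _)
    calc (⌊x * N⌋₊ : ℝ) * trapFactor a N ^ (N - ⌊x * N⌋₊)
        ≤ N * (N : ℝ) ^ (-(a * (1 - x))) := by
          refine mul_le_mul (hfl.trans hxN) ?_ (pow_pos (trapFactor_pos a N) _).le hN0.le
          rw [trapFactor_pow, ← exp_neg_mul_trapScale a (1 - x) hN, Nat.cast_sub hK]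
          refine Real.exp_le_exp.mpr (neg_le_neg (mul_le_mul_of_nonneg_left ?_
            (mul_pos ha0 (trapScale_pos hN)).le))
          linarith
      _ = (N : ℝ) ^ (-(a * (1 - x) - 1)) := by
          rw [neg_sub, sub_eq_add_neg 1 (a * _), Real.rpow_add hN0, Real.rpow_one]
  -- Take 1 - 1/a < y < x < b with K = ⌊xN⌋, L = ⌈yN⌉: then (K - L) q^{N-L} grows at least like
  -- N^{1-a(1-y)}, a positive power. The minimum with 1 ensures L ≤ N.
  · obtain ⟨x, hx1, hx2⟩ := exists_between (lt_min hb (by linarith [one_div_pos.mpr ha0] :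
      1 - 1 / a < 1))
    obtain ⟨y, hy1, hy2⟩ := exists_between hx1
    have hy0 : 0 < y := by linarith
    have hx0 : 0 < x := hy0.trans hy2
    have hay : 0 < 1 - a * (1 - y) := by
      have := mul_lt_mul_of_pos_left hy1 ha0
      rw [mul_sub, mul_one_div_cancel ha0.ne'] at this
      linarith
    have hexp : Tendsto (fun N : ℕ => Real.exp (-(((⌊x * N⌋₊ : ℝ) / N - ⌈y * N⌉₊ / N) *
        (N : ℝ) ^ (1 - a * (1 - y))))) atTop (𝓝 0) := by
      have h1 := (tendsto_nat_floor_mul_div_atTop hx0.le).comp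
        (tendsto_natCast_atTop_atTop (R := ℝ))
      have h2 := (tendsto_nat_ceil_mul_div_atTop hy0.le).comp
        (tendsto_natCast_atTop_atTop (R := ℝ))
      have h3 := (tendsto_rpow_atTop hay).comp (tendsto_natCast_atTop_atTop (R := ℝ))
      exact Real.tendsto_exp_neg_atTop_nhds_zero.comp
        (Tendsto.pos_mul_atTop (sub_pos.mpr hy2) (h1.sub h2) h3)
    have hlim : Tendsto (fun N : ℕ => (⌊x * N⌋₊ : ℝ) / N + Real.exp (-(((⌊x * N⌋₊ : ℝ) / N -
        ⌈y * N⌉₊ / N) * (N : ℝ) ^ (1 - a * (1 - y))))) atTop (𝓝 x) := by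
      have h1 := (tendsto_nat_floor_mul_div_atTop hx0.le).comp
        (tendsto_natCast_atTop_atTop (R := ℝ))
      simpa using h1.add hexp
    have hxy : ∀ᶠ N : ℕ in atTop, ⌈y * N⌉₊ ≤ ⌊x * N⌋₊ := by
      have h3 := (tendsto_natCast_atTop_atTop (R := ℝ)).const_mul_atTop (sub_pos.mpr hy2)
      filter_upwards [h3.eventually_ge_atTop 1] with N hN
      refine Nat.le_floor ((Nat.ceil_lt_add_one (by positivity)).le.trans ?_)
      linarith
    filter_upwards [hlim.eventually_lt_const (hx2.trans_le (min_le_left _ _)), hxy,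
      eventually_ge_atTop 2] with N hbN hLK hN
    refine lt_of_le_of_lt ?_ hbN
    have hN0 : (0 : ℝ) < N := by positivity
    have hLN : ⌈y * N⌉₊ ≤ N := Nat.ceil_le.mpr
      (mul_le_of_le_one_left hN0.le (by linarith [min_le_right b 1]))
    have h := oscillatorOccupation_zero_le (trapFactor_pos a N) (trapFactor_lt_one ha0 hN)
      (N := N) hLK
    rw [one_div_mul_eq_div, div_le_iff₀ hN0, add_mul, div_mul_cancel₀ _ hN0.ne',
      mul_comm (Real.exp _)]
    refine h.trans (add_le_add_right (mul_le_mul_of_nonneg_left ?_ hN0.le) _)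
    refine Real.exp_le_exp.mpr (neg_le_neg ?_)
    have hpow : (N : ℝ) ^ (-(a * (1 - y))) ≤ trapFactor a N ^ (N - ⌈y * N⌉₊) := by
      rw [trapFactor_pow, ← exp_neg_mul_trapScale a (1 - y) hN, Nat.cast_sub hLN]
      refine Real.exp_le_exp.mpr (neg_le_neg (mul_le_mul_of_nonneg_left ?_
        (mul_pos ha0 (trapScale_pos hN)).le))
      linarith [Nat.le_ceil (y * N)]
    calc _ = ((⌊x * N⌋₊ : ℝ) - ⌈y * N⌉₊) * (N : ℝ) ^ (-(a * (1 - y))) := by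
          rw [sub_eq_add_neg 1, Real.rpow_add hN0, Real.rpow_one]
          field_simp
      _ ≤ _ := mul_le_mul_of_nonneg_left hpow (sub_nonneg.mpr (Nat.cast_le.mpr hLK))

lemma tendsto_rpow_mul_oscillatorOccupation_one (ha : 1 < a) {η : ℝ} (hη : η < 1) :
    Tendsto (fun N : ℕ => (N : ℝ) ^ (-η) * oscillatorOccupation (trapFactor a N) N 1)
      atTop atTop := by
  have ha0 : 0 < a := one_pos.trans ha
  have hdiv (s : ℝ) (hs : 0 < s) :
      Tendsto (fun N : ℕ => (N : ℝ) ^ s / Real.log N) atTop atTop := by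
    have h0 := tendsto_log_rpow_mul_rpow_neg 1 hs
    have hpos : ∀ᶠ N : ℕ in atTop, 0 < Real.log N ^ (1 : ℝ) * (N : ℝ) ^ (-s) := by
      filter_upwards [eventually_ge_atTop 2] with N hN
      have : 0 < Real.log N := Real.log_pos (by exact_mod_cast hN)
      positivity
    refine (tendsto_nhdsWithin_iff.mpr ⟨h0, hpos⟩).inv_tendsto_nhdsGT_zero.congr fun N => ?_
    rw [Pi.inv_apply, Real.rpow_one, Real.rpow_neg (Nat.cast_nonneg N), mul_inv, inv_inv,
      div_eq_inv_mul]
  have hlow : Tendsto (fun N : ℕ => (Real.exp (-a) / 4) * ((N : ℝ) ^ (1 - η) / Real.log N))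
      atTop atTop :=
    (hdiv _ (sub_pos.mpr hη)).const_mul_atTop (by positivity)
  refine tendsto_atTop_mono' atTop ?_ hlow
  have hsmall : ∀ᶠ N : ℕ in atTop, Real.exp a * (N : ℝ) ^ (-(a - 1)) ≤ 1 / 2 := by
    have := (tendsto_natCast_rpow_neg (sub_pos.mpr ha)).const_mul (Real.exp a)
    rw [mul_zero] at this
    exact this.eventually_le_const (by norm_num)
  -- From 2 on, taking the floor loses at most half.
  have hbig : ∀ᶠ N : ℕ in atTop, 2 ≤ (N : ℝ) / Real.log N := by
    simpa using (hdiv 1 one_pos).eventually_ge_atTop 2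
  filter_upwards [hsmall, hbig, tendsto_log_natCast_atTop.eventually_ge_atTop 1,
    eventually_ge_atTop 2] with N hsm hbg hlog hN
  have hN0 : (0 : ℝ) < N := by positivity
  have hl0 : 0 < Real.log N := by linarith
  set K := ⌊(N : ℝ) / Real.log N⌋₊ with hKdef
  have hKle : (K : ℝ) ≤ N / Real.log N := Nat.floor_le (by positivity)
  have hKge : N / Real.log N / 2 ≤ (K : ℝ) := by
    have := Nat.lt_floor_add_one ((N : ℝ) / Real.log N)
    -- Floor exceeds r - 1 ≥ r/2 once r = N / ln N ≥ 2.
    linarith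
  have hKN' : (K : ℝ) ≤ N := hKle.trans (div_le_self hN0.le hlog)
  have hKN : K ≤ N := by exact_mod_cast hKN'
  have hq0 := trapFactor_pos a N
  have h := mul_le_oscillatorOccupation hq0 (trapFactor_lt_one ha0 hN) hKN 1
  rw [pow_one] at h
  have hqK : Real.exp (-a) ≤ trapFactor a N ^ K := by
    rw [trapFactor_pow]
    refine Real.exp_le_exp.mpr (neg_le_neg ?_)
    calc a * trapScale N * K ≤ a * trapScale N * (N / Real.log N) :=
          mul_le_mul_of_nonneg_left hKle (mul_pos ha0 (trapScale_pos hN)).le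
      _ = a := by rw [trapScale]; field_simp
  have hqNK : trapFactor a N ^ (N - K) ≤ Real.exp a * (N : ℝ) ^ (-a) := by
    have h1 : trapFactor a N ^ (N - K) * trapFactor a N ^ K = (N : ℝ) ^ (-a) := by
      rw [← pow_add, Nat.sub_add_cancel hKN, trapFactor_pow_self a hN]
    rw [← h1, mul_left_comm]
    refine le_mul_of_one_le_right (by positivity) ?_
    have := mul_le_mul_of_nonneg_left hqK (Real.exp_pos a).le
    rwa [← Real.exp_add, add_neg_cancel, Real.exp_zero] at this
  have hKq : K * trapFactor a N ^ (N - K) ≤ 1 / 2 := by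
    refine le_trans (mul_le_mul hKN' hqNK (by positivity) hN0.le) (le_trans (le_of_eq ?_) hsm)
    rw [neg_sub, sub_eq_add_neg, Real.rpow_add hN0, Real.rpow_one]
    ring
  have hocc : Real.exp (-a) * (N / Real.log N / 2 * (1 / 2)) ≤
      oscillatorOccupation (trapFactor a N) N 1 :=
    le_trans (mul_le_mul hqK (mul_le_mul hKge (by linarith) (by norm_num) (Nat.cast_nonneg _))
      (by positivity) (by positivity)) h
  calc _ = (N : ℝ) ^ (-η) * (Real.exp (-a) * (N / Real.log N / 2 * (1 / 2))) := by
        rw [sub_eq_add_neg, Real.rpow_add hN0, Real.rpow_one]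
        ring
    _ ≤ _ := mul_le_mul_of_nonneg_left hocc (by positivity)

lemma tendsto_rpow_mul_oscillatorOccupation (ha0 : 0 < a) (ha : a < 1) {i : ℕ → ℕ}
    (hi : (fun N : ℕ => (i N : ℝ)) =o[atTop]
      (fun N : ℕ => (N : ℝ) ^ (1 - a) / (Real.log N) ^ 2)) :
    Tendsto (fun N : ℕ => (N : ℝ) ^ (-a) * oscillatorOccupation (trapFactor a N) N (i N))
      atTop (𝓝 1) := by
  -- Long enough that (1 - N^{-a})^{K+1} ≤ 1/N, short enough that q^K → 1; q^{iK} → 1 then needs i ·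
  -- N^a ln N · ln N / N → 0, exactly the hypothesis on `i`.
  set K : ℕ → ℕ := fun N => ⌊(N : ℝ) ^ a * Real.log N⌋₊ with hKdef
  have hKle {N : ℕ} (hN : 2 ≤ N) : (K N : ℝ) ≤ (N : ℝ) ^ a * Real.log N :=
    Nat.floor_le (mul_nonneg (by positivity)
      (Real.log_nonneg (by exact_mod_cast one_le_two.trans hN)))
  have hKN : ∀ᶠ N : ℕ in atTop, K N ≤ N := by
    filter_upwards [(tendsto_log_rpow_mul_rpow_neg 1 (sub_pos.mpr ha)).eventually_le_const
      one_pos, eventually_ge_atTop 2] with N h hN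
    have hN0 : (0 : ℝ) < N := by positivity
    have : (K N : ℝ) ≤ N := by
      refine (hKle hN).trans ?_
      calc (N : ℝ) ^ a * Real.log N = N * (Real.log N ^ (1 : ℝ) * (N : ℝ) ^ (-(1 - a))) := by
            rw [neg_sub, sub_eq_add_neg, Real.rpow_add hN0, Real.rpow_neg hN0.le, Real.rpow_one,
              Real.rpow_one]
            field_simp
        _ ≤ N := mul_le_of_le_one_right hN0.le h
    exact_mod_cast this
  have hKt {N : ℕ} (hN : 2 ≤ N) :
      a * trapScale N * K N ≤ a * (Real.log N ^ (2 : ℝ) * (N : ℝ) ^ (-(1 - a))) := by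
    have hN0 : (0 : ℝ) < N := by positivity
    calc a * trapScale N * K N ≤ a * trapScale N * ((N : ℝ) ^ a * Real.log N) :=
          mul_le_mul_of_nonneg_left (hKle hN) (mul_pos ha0 (trapScale_pos hN)).le
      _ = _ := by
          rw [neg_sub, sub_eq_add_neg, Real.rpow_add hN0, Real.rpow_neg hN0.le, Real.rpow_one,
            Real.rpow_two, trapScale]
          field_simp
  have hqK : Tendsto (fun N => trapFactor a N ^ K N) atTop (𝓝 1) := by
    have h0 : Tendsto (fun N : ℕ => a * trapScale N * K N) atTop (𝓝 0) := by
      refine squeeze_zero' ?_ (eventually_atTop.mpr ⟨2, fun N hN => hKt hN⟩) ?_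
      · filter_upwards [eventually_ge_atTop 2] with N hN
        exact mul_nonneg (mul_pos ha0 (trapScale_pos hN)).le (Nat.cast_nonneg _)
      · simpa using (tendsto_log_rpow_mul_rpow_neg 2 (sub_pos.mpr ha)).const_mul a
    simp only [trapFactor_pow]
    simpa [Function.comp_def] using (Real.continuous_exp.tendsto _).comp h0.neg
  have hqiK : Tendsto (fun N => (trapFactor a N ^ i N) ^ K N) atTop (𝓝 1) := by
    have h0 : Tendsto (fun N : ℕ => (i N : ℝ) * (a * trapScale N * K N)) atTop (𝓝 0) := by
      refine squeeze_zero' (g := fun N : ℕ =>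
        a * ((i N : ℝ) / ((N : ℝ) ^ (1 - a) / (Real.log N) ^ 2))) ?_ ?_ ?_
      · filter_upwards [eventually_ge_atTop 2] with N hN
        exact mul_nonneg (Nat.cast_nonneg _)
          (mul_nonneg (mul_pos ha0 (trapScale_pos hN)).le (Nat.cast_nonneg _))
      · filter_upwards [eventually_ge_atTop 2] with N hN
        refine (mul_le_mul_of_nonneg_left (hKt hN) (Nat.cast_nonneg (i N))).trans (le_of_eq ?_)
        rw [Real.rpow_neg (Nat.cast_nonneg N), Real.rpow_two, div_div_eq_mul_div]
        ring
      · simpa using hi.tendsto_div_nhds_zero.const_mul a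
    have h1 := (Real.continuous_exp.tendsto _).comp h0.neg
    rw [neg_zero, Real.exp_zero] at h1
    refine h1.congr fun N => ?_
    rw [← pow_mul, trapFactor_pow, Function.comp_apply]
    congr 1
    push_cast
    ring
  have hpow {N : ℕ} (hN : 2 ≤ N) (hK : K N ≤ N) :
      trapFactor a N ^ (N - K N) * trapFactor a N ^ K N = (N : ℝ) ^ (-a) := by
    rw [← pow_add, Nat.sub_add_cancel hK, trapFactor_pow_self a hN]
  have hr : Tendsto (fun N => 1 - trapFactor a N ^ (N - K N)) atTop (𝓝 1) := by
    have h0 := (tendsto_natCast_rpow_neg ha0).div hqK one_ne_zero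
    rw [zero_div] at h0
    have h1 : Tendsto (fun N => trapFactor a N ^ (N - K N)) atTop (𝓝 0) := by
      refine h0.congr' ?_
      filter_upwards [hKN, eventually_ge_atTop 2] with N hK hN
      rw [Pi.div_apply, ← hpow hN hK, mul_div_cancel_right₀ _ (pow_pos (trapFactor_pos a N) _).ne']
    simpa using h1.const_sub 1
  have hrK : Tendsto (fun N => (1 - trapFactor a N ^ (N - K N)) ^ (K N + 1)) atTop (𝓝 0) := by
    refine squeeze_zero' ?_ ?_ tendsto_one_div_atTop_nhds_zero_nat
    · filter_upwards [eventually_ge_atTop 2] with N hN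
      exact pow_nonneg (sub_nonneg.mpr
        (pow_le_one₀ (trapFactor_pos a N).le (trapFactor_lt_one ha0 hN).le)) _
    · filter_upwards [hKN, eventually_ge_atTop 2] with N hK hN
      have hN0 : (0 : ℝ) < N := by positivity
      have hq0 := trapFactor_pos a N
      have hq1 := (trapFactor_lt_one ha0 hN).le
      have hle : (N : ℝ) ^ (-a) ≤ trapFactor a N ^ (N - K N) := by
        rw [← hpow hN hK]
        exact mul_le_of_le_one_right (by positivity) (pow_le_one₀ hq0.le hq1)
      calc (1 - trapFactor a N ^ (N - K N)) ^ (K N + 1)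
          ≤ Real.exp (-trapFactor a N ^ (N - K N)) ^ (K N + 1) :=
            pow_le_pow_left₀ (sub_nonneg.mpr (pow_le_one₀ hq0.le hq1))
              (Real.one_sub_le_exp_neg _) _
        _ = Real.exp (-((K N + 1 : ℝ) * trapFactor a N ^ (N - K N))) := by
            rw [← Real.exp_nat_mul]
            congr 1
            push_cast
            ring
        _ ≤ Real.exp (-Real.log N) := by
            refine Real.exp_le_exp.mpr (neg_le_neg ?_)
            calc Real.log N = ((N : ℝ) ^ a * Real.log N) * (N : ℝ) ^ (-a) := by
                  rw [Real.rpow_neg hN0.le]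
                  field_simp
              _ ≤ _ := mul_le_mul (Nat.lt_floor_add_one _).le hle (by positivity) (by positivity)
        _ = 1 / N := by rw [Real.exp_neg, Real.exp_log hN0, one_div]
  have hlow := hqK.mul (hqiK.mul (hr.sub hrK))
  rw [sub_zero, mul_one, mul_one] at hlow
  refine tendsto_of_tendsto_of_tendsto_of_le_of_le' hlow tendsto_const_nhds ?_ ?_
  · filter_upwards [hKN, eventually_ge_atTop 2] with N hK hN
    have := pow_mul_le_pow_mul_oscillatorOccupation (trapFactor_pos a N)
      (trapFactor_lt_one ha0 hN) hK (i N)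
    rwa [trapFactor_pow_self a hN] at this
  · filter_upwards [eventually_ge_atTop 2] with N hN
    rw [← trapFactor_pow_self a hN]
    exact pow_mul_oscillatorOccupation_le_one (trapFactor_pos a N) (trapFactor_lt_one ha0 hN) N _

end BoseGas

theorem theorem4 (hbar omega beta a : ℝ) (hhbar : 0 < hbar) (homega : 0 < omega)
    (hbeta : 0 < beta) (ha : a = hbar * omega * beta) :
    -- the canonical ensemble is well defined
    (∀ N : ℕ, 2 ≤ N → Summable (BoseGas.weight beta (BoseGas.trapLevel hbar omega N) N)) ∧
    -- complete generalized condensation on the `o(N)` levels `j < 2 / a_N`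
    ((fun N : ℕ => (BoseGas.levelCutoff a N : ℝ)) =o[atTop] (fun N : ℕ => (N : ℝ)) ∧
      Tendsto (fun N : ℕ => (1 / (N : ℝ)) *
          ∑ j ∈ Finset.range (BoseGas.levelCutoff a N),
            BoseGas.trapOccupation hbar omega beta N j)
        atTop (𝓝 1)) ∧
    -- equal occupation of the low-lying levels for `a < 1`
    (a < 1 → ∀ i : ℕ → ℕ,
      (fun N : ℕ => (i N : ℝ)) =o[atTop]
          (fun N : ℕ => (N : ℝ) ^ (1 - a) / (Real.log N) ^ 2) →
        Tendsto (fun N : ℕ => (N : ℝ) ^ (-a) *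
            BoseGas.trapOccupation hbar omega beta N (i N)) atTop (𝓝 1)) ∧
    -- `a > 1`: no fragmentation, near-macroscopic first level, critical condensate above level `0`
    (1 < a →
      (∀ i : ℕ, 1 ≤ i →
        Tendsto (fun N : ℕ => (1 / (N : ℝ)) *
            BoseGas.trapOccupation hbar omega beta N i) atTop (𝓝 0)) ∧
      (∀ η : ℝ, η < 1 →
        Tendsto (fun N : ℕ => (N : ℝ) ^ (-η) *
            BoseGas.trapOccupation hbar omega beta N 1) atTop atTop) ∧
      Tendsto (fun N : ℕ => (1 / (N : ℝ)) *
          ∑ j ∈ Finset.Ico 1 (BoseGas.levelCutoff a N),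
            BoseGas.trapOccupation hbar omega beta N j)
        atTop (𝓝 (1 / a))) := by
  have ha0 : 0 < a := by
    rw [ha]
    positivity
  have hocc {N : ℕ} (hN : 2 ≤ N) (i : ℕ) := BoseGas.trapOccupation_eq ha ha0 hN i
  refine ⟨fun N hN => BoseGas.summable_weight (BoseGas.summable_exp_neg_harmonic
    (mul_pos ha0 (BoseGas.trapScale_pos hN)) (BoseGas.trapLevel_eq ha N)) N,
    ⟨BoseGas.isLittleO_levelCutoff ha0, ?_⟩, fun ha1 i hi => ?_,
    fun ha1 => ⟨fun i hi => ?_, fun η hη => ?_, ?_⟩⟩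
  · refine (BoseGas.tendsto_sum_range_levelCutoff ha0).congr' ?_
    filter_upwards [eventually_ge_atTop 2] with N hN
    simp only [hocc hN]
  · refine (BoseGas.tendsto_rpow_mul_oscillatorOccupation ha0 ha1 hi).congr' ?_
    filter_upwards [eventually_ge_atTop 2] with N hN
    rw [hocc hN]
  · refine (BoseGas.tendsto_oscillatorOccupation_div ha0 hi).congr' ?_
    filter_upwards [eventually_ge_atTop 2] with N hN
    rw [hocc hN]
  · refine (BoseGas.tendsto_rpow_mul_oscillatorOccupation_one ha1 hη).congr' ?_
    filter_upwards [eventually_ge_atTop 2] with N hN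
    rw [hocc hN]
  -- The critical density is the total 1 minus the ground-level share 1 - 1/a.
  · have h := (BoseGas.tendsto_sum_range_levelCutoff ha0).sub
      (BoseGas.tendsto_oscillatorOccupation_zero_div ha1)
    rw [sub_sub_cancel] at h
    refine h.congr' ?_
    filter_upwards [eventually_ge_atTop 2] with N hN
    have hL : 0 < BoseGas.levelCutoff a N :=
      Nat.ceil_pos.mpr (div_pos two_pos (mul_pos ha0 (BoseGas.trapScale_pos hN)))
    simp only [hocc hN]
    rw [← mul_sub, Finset.sum_range_eq_add_Ico _ hL, add_sub_cancel_left]
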